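/- Let $G$ be a finite undirected graph with non-empty vertex set $V$ (the interaction graph; it need not be connected). Call a set $S\subseteq V$ viable if the induced subgraph $G[S]$ is connected (so $S\neq\emptyset$). A graphical coalition game $\mathcal G$ on $G$ is a function $v:2^V\to\mathbb N=\{0,1,2,\dots\}$ with $v(S)=0$ for every non-viable $S$. Its covering number is $$\kappa(\mathcal G)=\min\Big\{\sum_{i\in V}x_i \;:\; x\in\mathbb N^V,\ \sum_{i\in S}x_i\ge v(S)\ \text{ for all } S\subseteq V\Big\},$$ and its packing number is $$\rho(\mathcal G)=\max\Big\{\sum_{S\subseteq V}v(S)\,y_S \;:\; y\in\mathbb N^{2^V},\ \sum_{S\ni i}y_S\le 1\ \text{ for all } i\in V\Big\}.$$ A thicket of $G$ is a collection $\mathcal H$ of subsets of $V$, each inducing a connected subgraph of $G$, any two of which share a vertex. Its hitting size $\tau(\mathcal H)$ is the minimum size of a vertex set that meets every member of $\mathcal H$, and the thicket number $\tau(G)$ is the maximum of $\tau(\mathcal H)$ over all thickets $\mathcal H$ of $G$. Theorem. (a) Every graphical coalition game $\mathcal G$ on $G$ satisfies $\kappa(\mathcal G)\le\tau(G)\,\rho(\mathcal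 G)$; that is, $\kappa(\mathcal G)/\rho(\mathcal G)\le\tau(G)$ whenever $\rho(\mathcal G)>0$. (b) Conversely, there is a graphical coalition game $\mathcal G$ on $G$ with $\rho(\mathcal G)>0$ and $\kappa(\mathcal G)/\rho(\mathcal G)\ge\tau(G)$; it can moreover be chosen superadditive, in the sense that $v(S)+v(T)\le v(S\cup T)$ for all disjoint $S,T\subseteq V$ such that $S\cup T$ is viable. -/

import Mathlib

namespace CoalitionGame

/-- A coalition `S` is viable over the interaction graph `G` if the induced subgraph `G[S]` is
connected (in particular, `S` is non-empty). -/
def Viable {V : Type*} (G : SimpleGraph V) (S : Finset V) : Prop :=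
  (G.induce (S : Set V)).Connected

/-- A graphical coalition game over the interaction graph `G`: a valuation function on coalitions,
with values in the natural numbers, that vanishes on the non-viable coalitions. -/
structure Game {V : Type*} (G : SimpleGraph V) where
  /-- the wealth that a coalition can generate by itself -/
  v : Finset V → ℕ
  v_eq_zero : ∀ S : Finset V, ¬ Viable G S → v S = 0

/-- Superadditivity for graphical games: two disjoint coalitions whose union is viable generate
together at least as much as they do separately. -/
def Game.Superadditive {V : Type*} [DecidableEq V] {G : SimpleGraph V} (g : Game G) : Prop :=
  ∀ S T : Finset V, Disjoint S T → Viable G (S ∪ T) → g.v S + g.v T ≤ g.v (S ∪ T)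

/-- The empty coalition is worth nothing. -/
theorem Game.v_empty {V : Type*} {G : SimpleGraph V} (g : Game G) : g.v ∅ = 0 := by
  apply g.v_eq_zero
  intro h
  obtain ⟨x⟩ := h.nonempty
  simpa using x.2

section LP

variable {V : Type*} [Fintype V] [DecidableEq V] {G : SimpleGraph V}

/-- `x` is an integral feasible solution of the covering linear program:
every coalition `S` is paid at least `v S`. -/
def Game.IsCover (g : Game G) (x : V → ℕ) : Prop :=
  ∀ S : Finset V, g.v S ≤ ∑ i ∈ S, x i

/-- `y` is an integral feasible solution of the packing linear program:
every agent is in at most one of the selected coalitions. -/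
def Game.IsPacking (_g : Game G) (y : Finset V → ℕ) : Prop :=
  ∀ i : V, ∑ S : Finset V with i ∈ S, y S ≤ 1

/-- The objective values of the integral covers. -/
def Game.coverValues (g : Game G) : Set ℕ :=
  {c | ∃ x : V → ℕ, g.IsCover x ∧ c = ∑ i, x i}

/-- The objective values of the integral packings. -/
def Game.packingValues (g : Game G) : Set ℕ :=
  {c | ∃ y : Finset V → ℕ, g.IsPacking y ∧ c = ∑ S, g.v S * y S}

/-- The covering number `κ`: the optimal integral value of the covering linear program. -/
noncomputable def Game.kappa (g : Game G) : ℕ := sInf g.coverValues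

/-- The packing number `ρ`: the optimal integral value of the packing linear program. -/
noncomputable def Game.rho (g : Game G) : ℕ := sSup g.packingValues

/-- The minimum that defines `κ` is attained. -/
theorem Game.isLeast_kappa (g : Game G) : IsLeast g.coverValues g.kappa := by
  have hne : g.coverValues.Nonempty := by
    refine ⟨_, fun _ => ∑ S, g.v S, fun S => ?_, rfl⟩
    rcases S.eq_empty_or_nonempty with rfl | ⟨i, hi⟩
    · simp [g.v_empty]
    · exact (Finset.single_le_sum (f := g.v) (fun _ _ => Nat.zero_le _) (Finset.mem_univ S)).trans
        (Finset.single_le_sum (f := fun _ : V => ∑ S, g.v S) (fun _ _ => Nat.zero_le _) hi)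
  exact ⟨Nat.sInf_mem hne, fun _ hc => Nat.sInf_le hc⟩

/-- The maximum that defines `ρ` is attained. -/
theorem Game.isGreatest_rho (g : Game G) : IsGreatest g.packingValues g.rho := by
  have hne : g.packingValues.Nonempty := ⟨_, fun _ => 0, fun i => by simp, rfl⟩
  have hb : BddAbove g.packingValues := by
    refine ⟨∑ S, g.v S, ?_⟩
    rintro c ⟨y, hy, rfl⟩
    refine Finset.sum_le_sum fun S _ => ?_
    rcases S.eq_empty_or_nonempty with rfl | ⟨i, hi⟩
    · simp [g.v_empty]
    · have h1 : y S ≤ 1 :=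
        (Finset.single_le_sum (f := y) (fun _ _ => Nat.zero_le _) (by simpa using hi)).trans (hy i)
      simpa using Nat.mul_le_mul_left (g.v S) h1
  exact ⟨Nat.sSup_mem hne hb, fun _ hc => le_csSup hb hc⟩

end LP

/-- A thicket of `G`: a collection of vertex sets, each inducing a connected subgraph of `G`, any
two of which share a vertex. -/
def IsThicket {V : Type*} (G : SimpleGraph V) (H : Finset (Finset V)) : Prop :=
  (∀ S ∈ H, Viable G S) ∧ ∀ S ∈ H, ∀ T ∈ H, ∃ i, i ∈ S ∧ i ∈ T

/-- `X` meets every member of `H`. -/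
def IsHittingSet {V : Type*} (H : Finset (Finset V)) (X : Finset V) : Prop :=
  ∀ S ∈ H, ∃ i, i ∈ S ∧ i ∈ X

/-- The hitting size of `H`: the minimum size of a hitting set. -/
noncomputable def hittingSize {V : Type*} (H : Finset (Finset V)) : ℕ :=
  sInf {c | ∃ X : Finset V, IsHittingSet H X ∧ c = X.card}

/-- The thicket number of `G`: the maximum hitting size of a thicket of `G`. -/
noncomputable def thicketNumber {V : Type*} (G : SimpleGraph V) : ℕ :=
  sSup {c | ∃ H : Finset (Finset V), IsThicket G H ∧ c = hittingSize H}

/-- The minimum that defines the hitting size of a thicket is attained. -/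
theorem isLeast_hittingSize {V : Type*} [Fintype V] {G : SimpleGraph V}
    {H : Finset (Finset V)} (hH : IsThicket G H) :
    IsLeast {c | ∃ X : Finset V, IsHittingSet H X ∧ c = X.card} (hittingSize H) := by
  refine ⟨Nat.sInf_mem ⟨_, Finset.univ, fun S hS => ?_, rfl⟩, fun _ hc => Nat.sInf_le hc⟩
  obtain ⟨i, hi, _⟩ := hH.2 S hS S hS
  exact ⟨i, hi, Finset.mem_univ i⟩

/-- The maximum that defines the thicket number is attained. -/
theorem isGreatest_thicketNumber {V : Type*} [Fintype V] (G : SimpleGraph V) :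
    IsGreatest {c | ∃ H : Finset (Finset V), IsThicket G H ∧ c = hittingSize H}
      (thicketNumber G) := by
  have hb : BddAbove {c | ∃ H : Finset (Finset V), IsThicket G H ∧ c = hittingSize H} := by
    refine ⟨Fintype.card V, ?_⟩
    rintro c ⟨H, hH, rfl⟩
    refine (isLeast_hittingSize hH).2 ⟨Finset.univ, fun S hS => ?_, rfl⟩
    obtain ⟨i, hi, _⟩ := hH.2 S hS S hS
    exact ⟨i, hi, Finset.mem_univ i⟩
  exact ⟨Nat.sSup_mem ⟨_, ∅, ⟨by simp, by simp⟩, rfl⟩ hb, fun _ hc => le_csSup hb hc⟩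

end CoalitionGame

/-! For (a), the core is a duality: if every thicket can be hit by `k` vertices, then `G` has a
`Vine` whose bags have at most `k` vertices. Unlike in a tree decomposition, an edge may join two
adjacent bags; this matches thickets, whose members must intersect and not merely touch. The duality
(`exists_vine`) is proved for all thickets by induction from large to small ones, and is then
applied to the empty thicket. Given such a vine, pay one unit to each vertex of the bag `X` at the
root of a lowest subtree containing a coalition of positive value. This costs at most `τ(G)`, and
`rho_reduce_lt` shows that the packing number drops. Induction on `ρ` gives (a). For (b), let the
winning coalitions be the viable sets containing a member of an optimal thicket. Any two of them
intersect, so `ρ = 1`, while the support of a cover is a hitting set. -/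

namespace CoalitionGame

/-! ### Connected vertex sets -/

section Connectivity

variable {V : Type*} {G : SimpleGraph V}

theorem Viable.nonempty {S : Finset V} (h : Viable G S) : S.Nonempty := by
  obtain ⟨x⟩ := SimpleGraph.Connected.nonempty h
  exact ⟨x.1, x.2⟩

/-- The separation arguments below use connectedness in this form. -/
theorem Viable.exists_adj {S : Finset V} (h : Viable G S) {Q : V → Prop} {a b : V}
    (ha : a ∈ S) (hb : b ∈ S) (hQa : Q a) (hQb : ¬ Q b) :
    ∃ c ∈ S, ∃ d ∈ S, Q c ∧ ¬ Q d ∧ G.Adj c d := by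
  obtain ⟨p⟩ := SimpleGraph.Connected.preconnected h ⟨a, ha⟩ ⟨b, hb⟩
  obtain ⟨e, -, h1, h2⟩ := p.exists_boundary_dart {x | Q x.1} hQa hQb
  exact ⟨e.fst.1, e.fst.2, e.snd.1, e.snd.2, h1, h2, e.adj⟩

theorem viable_singleton (x : V) : Viable G {x} := by
  unfold Viable
  rw [Finset.coe_singleton, SimpleGraph.induce_singleton_eq_top]
  exact SimpleGraph.connected_top

theorem Viable.insert [DecidableEq V] {S : Finset V} (h : Viable G S) {a b : V} (ha : a ∈ S)
    (hab : G.Adj a b) : Viable G (insert b S) := by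
  unfold Viable
  have := SimpleGraph.induce_union_connected (SimpleGraph.Connected.preconnected h)
    (SimpleGraph.induce_pair_connected_of_adj hab).preconnected ⟨a, ha, by simp⟩
  have e : ((S : Set V) ∪ {a, b}) = ((Insert.insert b S : Finset V) : Set V) := by
    ext x
    simp only [Set.mem_union, Finset.mem_coe, Set.mem_insert_iff, Set.mem_singleton_iff,
      Finset.coe_insert]
    constructor
    · rintro (h | rfl | rfl) <;> simp_all
    · tauto
  rwa [e] at this

theorem Game.viable_of_pos (g : Game G) {S : Finset V} (h : 0 < g.v S) : Viable G S := by
  by_contra hn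
  exact h.ne' (g.v_eq_zero S hn)

/-- The component of a vertex after the deletion of `X`. -/
theorem exists_component [Fintype V] [DecidableEq V] (G : SimpleGraph V) (X : Finset V) {x : V}
    (hx : x ∉ X) :
    ∃ C : Finset V, Viable G C ∧ x ∈ C ∧ Disjoint C X ∧
      ∀ a ∈ C, ∀ b, G.Adj a b → b ∈ C ∨ b ∈ X := by
  obtain ⟨C, hC⟩ := Set.Finite.exists_maximal
    (s := {C : Finset V | Viable G C ∧ x ∈ C ∧ Disjoint C X}) (Set.toFinite _)
    ⟨{x}, viable_singleton x, by simp, by simpa using hx⟩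
  obtain ⟨hv, hxC, hd⟩ := hC.prop
  refine ⟨C, hv, hxC, hd, fun a ha b hab => ?_⟩
  by_contra! hb
  have hle := hC.le_of_ge (y := insert b C)
    ⟨hv.insert ha hab, by simp [hxC], by simp [hb.2, hd]⟩ (Finset.subset_insert _ _)
  exact hb.1 (hle (Finset.mem_insert_self _ _))

end Connectivity

/-! ### Vines: rerooting and projection -/

section Vine

variable {V : Type*} [DecidableEq V]

/-- `Vine G A R U`: the graph `G[U]` has a decomposition along a rooted tree with root bag `R`,
all of whose bags satisfy `A`; the bags that contain a given vertex form a subtree, and the ends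
of an edge lie in a common bag or in adjacent bags. -/
inductive Vine (G : SimpleGraph V) (A : Finset V → Prop) : Finset V → Finset V → Prop
  | leaf {R} : A R → Vine G A R R
  | glue {R U W} : Vine G A R U → Vine G A R W → U ∩ W ⊆ R →
      (∀ a ∈ U, ∀ b ∈ W, G.Adj a b → a ∈ R ∨ b ∈ R) → Vine G A R (U ∪ W)
  | extend {R U Q} : Vine G A R U → A Q → Q ∩ U ⊆ R →
      (∀ a ∈ Q, ∀ b ∈ U, G.Adj a b → a ∈ R ∨ b ∈ R ∨ b ∈ Q) → Vine G A Q (U ∪ Q)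

namespace Vine

variable {G : SimpleGraph V} {A B : Finset V → Prop} {R U W : Finset V}

theorem root_subset (h : Vine G A R U) : R ⊆ U := by
  induction h with
  | leaf => exact subset_rfl
  | glue _ _ _ _ ih _ => exact ih.trans Finset.subset_union_left
  | extend => exact Finset.subset_union_right

theorem root_prop (h : Vine G A R U) : A R := by
  induction h with
  | leaf h => exact h
  | extend _ h => exact h
  | glue _ _ _ _ ih => exact ih

theorem mono (hAB : ∀ S, A S → B S) (h : Vine G A R U) : Vine G B R U := by
  induction h with
  | leaf h => exact leaf (hAB _ h)
  | glue _ _ h1 h2 ih1 ih2 => exact glue ih1 ih2 h1 h2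
  | extend _ h h1 h2 ih => exact extend ih (hAB _ h) h1 h2

/-- The set `W` stands for the rest of the tree, hung on the root `R`. Quantifying over it lets the
induction move the root downwards, turning what lay above into another subtree. -/
theorem reroot_aux (h : Vine G A R U) :
    Vine G B R U ∨ ∃ S, ¬ B S ∧ ∀ W, Vine G A R W → U ∩ W ⊆ R →
      (∀ a ∈ U, ∀ b ∈ W, G.Adj a b → a ∈ R ∨ b ∈ R) → Vine G A S (U ∪ W) := by
  induction h with
  | @leaf R h =>
    by_cases hB : B R
    · exact .inl (leaf hB)
    · refine .inr ⟨R, hB, fun W hW _ _ => ?_⟩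
      rwa [Finset.union_eq_right.2 hW.root_subset]
  | @glue R U₁ U₂ h₁ h₂ h3 h4 ih₁ ih₂ =>
    rcases ih₁ with ih₁ | ⟨S, hS, ih₁⟩
    · rcases ih₂ with ih₂ | ⟨S, hS, ih₂⟩
      · exact .inl (glue ih₁ ih₂ h3 h4)
      · refine .inr ⟨S, hS, fun W hW h5 h6 => ?_⟩
        have := ih₂ (U₁ ∪ W) (glue h₁ hW (by grind) (by grind)) (by grind)
          (by intro a ha b hb hab; have := hab.symm; grind)
        rwa [← Finset.union_assoc, Finset.union_comm U₂] at this
    · refine .inr ⟨S, hS, fun W hW h5 h6 => ?_⟩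
      have := ih₁ (U₂ ∪ W) (glue h₂ hW (by grind) (by grind)) (by grind) (by grind)
      rwa [← Finset.union_assoc] at this
  | @extend R U Q h hQ h1 h2 ih =>
    by_cases hB : B Q
    · rcases ih with ih | ⟨S, hS, ih⟩
      · exact .inl (extend ih hB h1 h2)
      · refine .inr ⟨S, hS, fun W hW h5 h6 => ?_⟩
        have hQW := hW.root_subset
        -- The edge between `R` and `Q` is reversed: `W`, rooted at `Q`, becomes a child of `R`.
        have := ih (W ∪ R) (extend hW h.root_prop
          (by have := h.root_subset; grind)
          (by have := h.root_subset; grind)) (by grind)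
          (by intro a ha b hb hab; have := hab.symm; grind)
        have hRU := h.root_subset
        have e : U ∪ (W ∪ R) = U ∪ Q ∪ W := by grind
        rwa [e] at this
    · exact .inr ⟨Q, hB, fun W hW h5 h6 => glue (extend h hQ h1 h2) hW h5 h6⟩

/-- Either all bags satisfy `B`, or the tree can be rooted at a bag that violates `B`. -/
theorem reroot (h : Vine G A R U) :
    Vine G B R U ∨ ∃ S, A S ∧ ¬ B S ∧ Vine G A S U := by
  refine (reroot_aux (B := B) h).imp_right ?_
  rintro ⟨S, hS, hW⟩
  have := hW R (leaf h.root_prop) Finset.inter_subset_right (by grind)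
  rw [Finset.union_eq_left.2 h.root_subset] at this
  exact ⟨S, this.root_prop, hS, this⟩

/-- A root bag `R` separates the vertices `U` of its subtree from a vertex set `Z` that lies on
the other side. -/
def Separates (G : SimpleGraph V) (Z R U : Finset V) : Prop :=
  Z ∩ U ⊆ R ∧ ∀ a ∈ U, ∀ b, G.Adj a b → a ∈ R ∨ b ∈ U

theorem Separates.left {Z : Finset V} (h : Separates G Z R (U ∪ W))
    (h2 : ∀ a ∈ U, ∀ b ∈ W, G.Adj a b → a ∈ R ∨ b ∈ R) (hR : R ⊆ U) : Separates G Z R U := by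
  obtain ⟨h3, h4⟩ := h
  exact ⟨by grind, by grind⟩

theorem Separates.right {Z : Finset V} (h : Separates G Z R (U ∪ W))
    (h2 : ∀ a ∈ U, ∀ b ∈ W, G.Adj a b → a ∈ R ∨ b ∈ R) (hR : R ⊆ W) : Separates G Z R W := by
  rw [Finset.union_comm] at h
  exact h.left (fun a ha b hb hab => (h2 b hb a ha hab.symm).symm) hR

theorem Separates.child {Z Q : Finset V} (h : Separates G Z Q (U ∪ Q)) (h1 : Q ∩ U ⊆ R)
    (h2 : ∀ a ∈ Q, ∀ b ∈ U, G.Adj a b → a ∈ R ∨ b ∈ R ∨ b ∈ Q) (hR : R ⊆ U) :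
    Separates G Z R U := by
  obtain ⟨h3, h4⟩ := h
  refine ⟨by grind, fun a ha b hab => ?_⟩
  have := h4 a (by grind) b hab
  have := hab.symm
  grind

/-- Projection of a decomposition to `G[C ∪ X]`: in each bag, the vertices outside of `C` are
replaced by the vertices of `X` in the subtree below. -/
theorem project {C X Z : Finset V}
    (hbag : ∀ R U, A R → Separates G Z R U → R ⊆ U → B ((R ∩ C) ∪ (U ∩ X)))
    (h : Vine G A R U) (hs : Separates G Z R U) :
    Vine G B ((R ∩ C) ∪ (U ∩ X)) (U ∩ (C ∪ X)) := by
  induction h with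
  | @leaf R h =>
    have := hbag R R h hs subset_rfl
    rw [← Finset.inter_union_distrib_left] at this ⊢
    exact leaf this
  | @glue R U₁ U₂ h₁ h₂ h3 h4 ih₁ ih₂ =>
    have r₁ := h₁.root_subset
    have r₂ := h₂.root_subset
    have s₁ := hs.left h4 r₁
    have s₂ := hs.right h4 r₂
    have hB := hbag R (U₁ ∪ U₂) h₁.root_prop hs (by grind)
    -- The two projected roots may differ, since each keeps only the part of `X` in its own subtree.
    -- A common bag is put above both before gluing.
    have v₁ := extend (ih₁ s₁) hB (by grind)
      (by intro a ha b hb hab; have := s₁.2 b (by grind) a hab.symm; grind)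
    have v₂ := extend (ih₂ s₂) hB (by grind)
      (by intro a ha b hb hab; have := s₂.2 b (by grind) a hab.symm; grind)
    have := glue v₁ v₂ (by grind) (by
      intro a ha b hb hab
      have := h4 a
      grind)
    convert this using 1
    grind
  | @extend R U Q h hQ h1 h2 ih =>
    have r := h.root_subset
    have hB := hbag Q (U ∪ Q) hQ hs (by grind)
    have := extend (ih (hs.child h1 h2 r)) hB (by grind) (by
      intro a ha b hb hab
      have := h2 a
      grind)
    convert this using 1
    grind

end Vine

end Vine

/-! ### Duality between thickets and vines -/

section Duality

variable {V : Type*} [Fintype V] [DecidableEq V] {G : SimpleGraph V}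

/-- A bag is admissible if it is small or fails to meet all members of `H`. -/
def Admissible (k : ℕ) (H : Finset (Finset V)) (S : Finset V) : Prop :=
  S.card ≤ k ∨ ∃ B ∈ H, Disjoint B S

/-- Unless the vine already serves `H`, some bag `Z` is large, meets all of `H` and avoids `C`.
Rooted at `Z`, the vine is projected to `C ∪ X`; as `Z` avoids `C`, the new root is exactly `X`.
Minimality of `X` keeps the new bags no larger than the old ones if they meet all of `H`. -/
theorem exists_vine_component {k : ℕ} {H : Finset (Finset V)} (hH : IsThicket G H)
    {X C : Finset V} (hX : IsHittingSet H X) (hXk : X.card ≤ k)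
    (hmin : ∀ Y, IsHittingSet H Y → X.card ≤ Y.card)
    (hCX : Disjoint C X) (hC : ∀ a ∈ C, ∀ b, G.Adj a b → b ∈ C ∨ b ∈ X)
    {R : Finset V} (hR : Vine G (Admissible k (insert C H)) R Finset.univ) :
    (∃ R, Vine G (Admissible k H) R Finset.univ) ∨ Vine G (Admissible k H) X (C ∪ X) := by
  rcases hR.reroot (B := Admissible k H) with h | ⟨Z, hZ, hZH, hv⟩
  · exact .inl ⟨R, h⟩
  right
  have hd := Finset.disjoint_left.1 hCX
  simp only [Admissible, not_or, not_exists, not_and, not_le] at hZH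
  have hZC : Disjoint C Z := by
    rcases hZ with hZ | ⟨B, hB, hBZ⟩
    · omega
    · rcases Finset.mem_insert.1 hB with rfl | hB
      · exact hBZ
      · exact absurd hBZ (hZH.2 B hB)
  have hZC' := Finset.disjoint_left.1 hZC
  have hmeet : ∀ B ∈ H, ∃ z, z ∈ B ∧ z ∈ Z := fun B hB => Finset.not_disjoint_iff.1 (hZH.2 B hB)
  have key := hv.project (B := Admissible k H) (C := C) (X := X) (Z := Z) ?_ ⟨by simp, by simp⟩
  · rwa [Finset.univ_inter, Finset.univ_inter, Finset.inter_comm,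
      Finset.disjoint_iff_inter_eq_empty.1 hZC, Finset.empty_union] at key
  intro S U hS hsep hSU
  by_contra hbad
  simp only [Admissible, not_or, not_exists, not_and, not_le] at hbad
  obtain ⟨hcard, hbad⟩ := hbad
  have hsepZ := hsep.1
  -- the bag `S` separates `X ∩ U` from `Z`, so by minimality of `X` it is large outside of `C`
  have hhit : IsHittingSet H ((X \ U) ∪ (S \ C)) := by
    intro B hB
    by_contra! hno
    obtain ⟨x, hxB, hxX⟩ := hX B hB
    obtain ⟨z, hzB, hzZ⟩ := hmeet B hB
    have hxU : x ∈ U := by have := hno x hxB; grind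
    have hzU : z ∉ U := by have := hno z hzB; grind
    -- An edge of `B` leaving `U ∪ C` must start in `S \ C` or end in `X \ U`, both of which `B`
    -- avoids.
    obtain ⟨c, hcB, d, hdB, hc, hdn, hcd⟩ := (hH.1 B hB).exists_adj
      (Q := fun y => y ∈ U ∨ y ∈ C) hxB hzB (.inl hxU) (by grind)
    have h1 := hno c hcB
    have h2 := hno d hdB
    have h3 := hC c
    have h4 := hsep.2 c
    grind
  have hle := hmin _ hhit
  have h1 : X.card ≤ (X \ U).card + (S \ C).card := hle.trans (Finset.card_union_le _ _)
  have h2 : (X \ U).card + (X ∩ U).card = X.card := Finset.card_sdiff_add_card_inter X U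
  have h3 : (S \ C).card + (S ∩ C).card = S.card := Finset.card_sdiff_add_card_inter S C
  have h4 := Finset.card_union_le (S ∩ C) (U ∩ X)
  rw [Finset.inter_comm U X] at h4 hcard hbad
  have h5 : k < S.card := by omega
  -- So `S` meets `C`, and being large it must be admissible by missing a member of `H` itself.
  have hne : (S ∩ C).Nonempty := by
    rw [Finset.nonempty_iff_ne_empty]
    intro h0
    rw [h0, Finset.empty_union] at hcard
    have := Finset.card_le_card (Finset.inter_subset_left (s₁ := X) (s₂ := U))
    omega
  obtain ⟨c, hc⟩ := hne
  rcases hS with hS | ⟨B, hB, hBS⟩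
  · omega
  rw [Finset.disjoint_left] at hBS
  have hBH : B ∈ H := by
    rcases Finset.mem_insert.1 hB with rfl | hB
    · grind
    · exact hB
  obtain ⟨x, hxB, hx⟩ := Finset.not_disjoint_iff.1 (hbad B hBH)
  obtain ⟨z, hzB, hzZ⟩ := hmeet B hBH
  -- `B` runs from `X ∩ U` to a vertex of `Z` outside `U`, so it must cross `S`, which it was
  -- assumed to miss.
  obtain ⟨c, hcB, d, hdB, hc, hdn, hcd⟩ := (hH.1 B hBH).exists_adj
    (Q := fun y => y ∈ U) hxB hzB (by grind) (by grind)
  have := hsep.2 c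
  grind

/-- If all thickets can be hit by `k` vertices, then every thicket admits a decomposition. -/
theorem exists_vine {k : ℕ} (hk : ∀ H, IsThicket G H → hittingSize H ≤ k)
    (H : Finset (Finset V)) (hH : IsThicket G H) :
    ∃ R, Vine G (Admissible k H) R Finset.univ := by
  induction hn : Fintype.card (Finset V) - H.card using Nat.strong_induction_on generalizing H with
  | _ n ih =>
  by_contra hcon
  obtain ⟨⟨X, hX, hXc⟩, hmin⟩ := isLeast_hittingSize hH
  have hXk : X.card ≤ k := hXc ▸ hk H hH
  have hXmin : ∀ Y, IsHittingSet H Y → X.card ≤ Y.card := fun Y hY => hXc ▸ hmin ⟨Y, hY, rfl⟩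
  -- Vines for the components of `G - X` are glued at the common root `X`; maximality of `U`
  -- replaces a recursion over components.
  obtain ⟨U, hU⟩ := Set.Finite.exists_maximal
    (s := {U | Vine G (Admissible k H) X U ∧ ∀ a ∈ U, ∀ b, G.Adj a b → a ∈ X ∨ b ∈ U})
    (Set.toFinite _) ⟨X, .leaf (.inl hXk), by grind⟩
  obtain ⟨hv, hcl⟩ := hU.prop
  have hXU := hv.root_subset
  by_cases hfull : U = Finset.univ
  · exact hcon ⟨X, hfull ▸ hv⟩
  obtain ⟨x, hx⟩ : ∃ x, x ∉ U := by
    by_contra! h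
    exact hfull (Finset.eq_univ_iff_forall.2 h)
  obtain ⟨C, hCv, hxC, hCX, hC⟩ := exists_component G X (fun h => hx (hXU h))
  have hd := Finset.disjoint_left.1 hCX
  have hCU : Disjoint C U := by
    rw [Finset.disjoint_left]
    intro c hc hcU
    obtain ⟨a, ha, b, hb, haU, hbU, hab⟩ :=
      hCv.exists_adj (Q := fun y => y ∈ U) hc hxC hcU hx
    have := hcl a haU b hab
    have := hd ha
    tauto
  have hvC : Vine G (Admissible k H) X (C ∪ X) := by
    by_cases hB : ∃ B ∈ H, Disjoint B C
    · exact .extend (.leaf (.inr hB)) (.inl hXk)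
        (by rw [Finset.inter_comm, Finset.disjoint_iff_inter_eq_empty.1 hCX]; simp) (by grind)
    · push Not at hB
      -- Here `C` meets every member of `H`, so adding it gives a strictly larger thicket, to which
      -- induction applies.
      have hCH : C ∉ H := fun h => by
        obtain ⟨i, hi, hi'⟩ := hX C h
        exact hd hi hi'
      have hT : IsThicket G (insert C H) := by
        refine ⟨fun S hS => ?_, fun S hS T hT => ?_⟩
        · rcases Finset.mem_insert.1 hS with rfl | hS
          exacts [hCv, hH.1 S hS]
        · rcases Finset.mem_insert.1 hS with rfl | hS <;>
            rcases Finset.mem_insert.1 hT with rfl | hT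
          · exact ⟨x, hxC, hxC⟩
          · obtain ⟨i, h1, h2⟩ := Finset.not_disjoint_iff.1 (hB T hT)
            exact ⟨i, h2, h1⟩
          · exact Finset.not_disjoint_iff.1 (hB S ‹_›)
          · exact hH.2 S hS T hT
      have hcard := Finset.card_insert_of_notMem hCH
      have hle := Finset.card_le_univ (insert C H)
      obtain ⟨R, hR⟩ := ih _ (by omega) (insert C H) hT rfl
      exact (exists_vine_component hH hX hXk hXmin hCX hC hR).resolve_left hcon
  have hd' := Finset.disjoint_left.1 hCU
  have hle := hU.le_of_ge (y := U ∪ (C ∪ X))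
    ⟨.glue hv hvC (by grind) (by grind), by grind⟩ Finset.subset_union_left
  exact hx (hle (by simp [hxC]))

/-- A lowest subtree of a decomposition that contains a set satisfying `F`. -/
theorem Vine.exists_lowest {A F : Finset V → Prop} (hF : ∀ S, F S → Viable G S)
    {R U : Finset V} (h : Vine G A R U) (hs : ∀ a ∈ U, ∀ b, G.Adj a b → a ∈ R ∨ b ∈ U)
    (hex : ∃ S, F S ∧ S ⊆ U) :
    ∃ X C, A X ∧ (∀ a ∈ C, ∀ b, G.Adj a b → b ∈ C ∨ b ∈ X) ∧ (∀ S, F S → ¬ S ⊆ C) ∧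
      ∃ T, F T ∧ T ⊆ C ∪ X := by
  induction h with
  | @leaf R h =>
    obtain ⟨S, hS, hSR⟩ := hex
    refine ⟨R, ∅, h, by simp, fun S hS hSe => ?_, S, hS, by simpa using hSR⟩
    exact (hF S hS).nonempty.ne_empty (Finset.subset_empty.1 hSe)
  | @glue R U₁ U₂ h₁ h₂ h3 h4 ih₁ ih₂ =>
    have hs' : Separates G ∅ R (U₁ ∪ U₂) := ⟨by simp, hs⟩
    by_cases e₁ : ∃ S, F S ∧ S ⊆ U₁
    · exact ih₁ (hs'.left h4 h₁.root_subset).2 e₁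
    by_cases e₂ : ∃ S, F S ∧ S ⊆ U₂
    · exact ih₂ (hs'.right h4 h₂.root_subset).2 e₂
    push Not at e₁ e₂
    obtain ⟨S, hS, hSU⟩ := hex
    -- A set satisfying `F` lies in neither side, so it has an edge across and must meet `R`.
    refine ⟨R, (U₁ ∪ U₂) \ R, h₁.root_prop, by grind, fun T hT hTU => ?_, S, hS, by grind⟩
    obtain ⟨a, haT, ha⟩ := Finset.not_subset.1 (e₁ T hT)
    obtain ⟨b, hbT, hb⟩ := Finset.not_subset.1 (e₂ T hT)
    obtain ⟨c, hcT, d, hdT, hc, hd, hcd⟩ := (hF T hT).exists_adj (Q := fun y => y ∈ U₁)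
      hbT haT (by grind) ha
    have h5 := hTU hcT
    have h6 := hTU hdT
    have := h4 c hc d (by grind) hcd
    grind
  | @extend R U Q h hQ h1 h2 ih =>
    have hs' : Separates G ∅ Q (U ∪ Q) := ⟨by simp, hs⟩
    by_cases e : ∃ S, F S ∧ S ⊆ U
    · exact ih (hs'.child h1 h2 h.root_subset).2 e
    push Not at e
    obtain ⟨S, hS, hSU⟩ := hex
    exact ⟨Q, U \ Q, hQ, by grind, fun T hT hTU => e T hT (hTU.trans Finset.sdiff_subset),
      S, hS, by grind⟩

end Duality

/-! ### Upper bound: paying a bag -/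

section Games

variable {V : Type*} [Fintype V] [DecidableEq V] {G : SimpleGraph V}

/-- The game that remains after one unit has been paid to every vertex of `X`, if a coalition is
credited at most one of these units. -/
def Game.reduce (g : Game G) (X : Finset V) : Game G where
  v S := if Disjoint S X then g.v S else g.v S - 1
  v_eq_zero S hS := by simp [g.v_eq_zero S hS]

theorem Game.kappa_le_reduce (g : Game G) (X : Finset V) :
    g.kappa ≤ X.card + (g.reduce X).kappa := by
  obtain ⟨⟨x, hx, hxk⟩, -⟩ := (g.reduce X).isLeast_kappa
  refine g.isLeast_kappa.2 ⟨fun i => (if i ∈ X then 1 else 0) + x i, fun S => ?_, ?_⟩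
  · have h := hx S
    rw [Finset.sum_add_distrib]
    simp only [reduce] at h
    split_ifs at h with hd
    · omega
    · obtain ⟨i, hiS, hiX⟩ := Finset.not_disjoint_iff.1 hd
      have : 1 ≤ ∑ i ∈ S, (if i ∈ X then 1 else 0) := by
        have := Finset.single_le_sum (f := fun i => if i ∈ X then 1 else 0)
          (fun _ _ => Nat.zero_le _) hiS
        simpa [hiX] using this
      omega
  · rw [Finset.sum_add_distrib, hxk]
    simp

theorem Game.le_rho (g : Game G) (S : Finset V) : g.v S ≤ g.rho := by
  refine g.isGreatest_rho.2 ⟨fun T => if T = S then 1 else 0, fun i => ?_, by simp⟩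
  rw [Finset.sum_ite_eq']
  split_ifs <;> simp

/-- If an optimal packing of the reduced game uses a positive coalition meeting `X`, the same
packing is worth more in `g`. Otherwise its positive coalitions avoid `X`; none lies inside `C`, so
by connectedness they avoid `C` too, and `T` can be added. -/
theorem Game.rho_reduce_lt (g : Game G) {X C T : Finset V}
    (hC : ∀ a ∈ C, ∀ b, G.Adj a b → b ∈ C ∨ b ∈ X) (hnull : ∀ S, 0 < g.v S → ¬ S ⊆ C)
    (hT : 0 < g.v T) (hTC : T ⊆ C ∪ X) : (g.reduce X).rho < g.rho := by
  obtain ⟨⟨y, hy, hyr⟩, -⟩ := (g.reduce X).isGreatest_rho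
  rw [hyr]
  have hle : ∀ S, (g.reduce X).v S ≤ g.v S := fun S => by
    simp only [reduce]
    split_ifs <;> omega
  by_cases hS : ∃ S, 0 < g.v S ∧ 0 < y S ∧ ¬ Disjoint S X
  · obtain ⟨S, hvS, hyS, hSX⟩ := hS
    refine lt_of_lt_of_le ?_ (g.isGreatest_rho.2 ⟨y, hy, rfl⟩)
    refine Finset.sum_lt_sum (fun S _ => Nat.mul_le_mul_right _ (hle S)) ⟨S, Finset.mem_univ _, ?_⟩
    refine Nat.mul_lt_mul_of_pos_right ?_ hyS
    simp only [reduce, if_neg hSX]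
    omega
  push Not at hS
  have hdisj : ∀ S, 0 < g.v S → 0 < y S → Disjoint S T := by
    intro S hv hyS
    have hSX := Finset.disjoint_left.1 (hS S hv hyS)
    rw [Finset.disjoint_left]
    intro i hiS hiT
    obtain ⟨j, hjS, hjC⟩ := Finset.not_subset.1 (hnull S hv)
    obtain ⟨c, hcS, d, hdS, hc, hd, hcd⟩ := (g.viable_of_pos hv).exists_adj
      (Q := fun y => y ∈ C) hiS hjS (by grind) hjC
    have := hC c hc d hcd
    grind
  have hTne := (g.viable_of_pos hT).nonempty
  have hyT : y T = 0 := by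
    by_contra h0
    have := hdisj T hT (Nat.pos_of_ne_zero h0)
    rw [Finset.disjoint_self_iff_empty] at this
    exact hTne.ne_empty this
  -- Worthless coalitions are dropped, since they might overlap `T`.
  let z : Finset V → ℕ := fun S => if g.v S = 0 then 0 else if S = T then 1 else y S
  have hz : g.IsPacking z := by
    intro i
    by_cases hi : i ∈ T
    · rw [Finset.sum_eq_single_of_mem T (by simpa using hi)]
      · simp only [z]
        split_ifs <;> omega
      · intro S hS hST
        by_contra h0
        simp only [z, if_neg hST] at h0
        have hv : g.v S ≠ 0 := fun h => h0 (if_pos h)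
        rw [if_neg hv] at h0
        exact Finset.disjoint_left.1 (hdisj S (Nat.pos_of_ne_zero hv) (Nat.pos_of_ne_zero h0))
          (Finset.mem_filter.1 hS).2 hi
    · refine (Finset.sum_le_sum fun S hS => ?_).trans (hy i)
      have hST : S ≠ T := by
        rintro rfl
        exact hi (Finset.mem_filter.1 hS).2
      simp only [z, if_neg hST]
      split_ifs <;> omega
  refine lt_of_lt_of_le ?_ (g.isGreatest_rho.2 ⟨z, hz, rfl⟩)
  refine Finset.sum_lt_sum (fun S _ => ?_) ⟨T, Finset.mem_univ _, ?_⟩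
  · by_cases hv : g.v S = 0
    · have := hle S
      rw [hv, Nat.le_zero] at this
      simp [this]
    · by_cases hST : S = T
      · rw [hST, hyT]
        simp
      · simp only [z, if_neg hv, if_neg hST]
        exact Nat.mul_le_mul_right _ (hle S)
  · simp [z, hyT, hT, hT.ne']

theorem Game.kappa_le (g : Game G) : g.kappa ≤ thicketNumber G * g.rho := by
  induction hn : g.rho using Nat.strong_induction_on generalizing g with
  | _ n ih =>
  by_cases hpos : ∃ S, 0 < g.v S
  · obtain ⟨S, hS⟩ := hpos
    -- For the empty thicket no bag can miss a member, so every bag is small.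
    obtain ⟨R, hR⟩ := exists_vine (G := G) (k := thicketNumber G)
      (fun H hH => (isGreatest_thicketNumber G).2 ⟨H, hH, rfl⟩) ∅ ⟨by simp, by simp⟩
    obtain ⟨X, C, hX, hC, hnull, T, hT, hTC⟩ := hR.exists_lowest
      (F := fun S => 0 < g.v S) (fun S => g.viable_of_pos) (by simp) ⟨S, hS, Finset.subset_univ S⟩
    have hXk : X.card ≤ thicketNumber G := by simpa [Admissible] using hX
    have hlt := g.rho_reduce_lt hC hnull hT hTC
    have h1 := ih _ (hn ▸ hlt) (g.reduce X) rfl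
    have h2 := g.kappa_le_reduce X
    calc g.kappa ≤ thicketNumber G + thicketNumber G * (g.reduce X).rho := by omega
      _ = thicketNumber G * ((g.reduce X).rho + 1) := by ring
      _ ≤ thicketNumber G * n := Nat.mul_le_mul_left _ (by omega)
  · push Not at hpos
    have : g.kappa ≤ 0 := g.isLeast_kappa.2 ⟨0, fun S => by simpa using hpos S, by simp⟩
    omega

/-! ### Sharpness: the simple game of a thicket -/

open Classical in
/-- The simple game whose winning coalitions are the viable coalitions that contain a member
of `H`. -/
noncomputable def simpleGame (G : SimpleGraph V) (H : Finset (Finset V)) : Game G where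
  v S := if Viable G S ∧ ∃ B ∈ H, B ⊆ S then 1 else 0
  v_eq_zero S hS := by simp [hS]

theorem simpleGame_pos_iff {H : Finset (Finset V)} {S : Finset V} :
    0 < (simpleGame G H).v S ↔ Viable G S ∧ ∃ B ∈ H, B ⊆ S := by
  simp only [simpleGame]
  split_ifs with h <;> simp [h]

theorem simpleGame_le_one {H : Finset (Finset V)} (S : Finset V) :
    (simpleGame G H).v S ≤ 1 := by
  simp only [simpleGame]
  split_ifs <;> simp

theorem simpleGame_not_disjoint {H : Finset (Finset V)} (hH : IsThicket G H) {S T : Finset V}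
    (hS : 0 < (simpleGame G H).v S) (hT : 0 < (simpleGame G H).v T) : ¬ Disjoint S T := by
  obtain ⟨-, B, hB, hBS⟩ := simpleGame_pos_iff.1 hS
  obtain ⟨-, B', hB', hBT⟩ := simpleGame_pos_iff.1 hT
  obtain ⟨i, hi, hi'⟩ := hH.2 B hB B' hB'
  exact Finset.not_disjoint_iff.2 ⟨i, hBS hi, hBT hi'⟩

theorem simpleGame_superadditive {H : Finset (Finset V)} (hH : IsThicket G H) :
    (simpleGame G H).Superadditive := by
  intro S T hST hv
  have h1 := simpleGame_le_one (G := G) (H := H) S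
  have h2 := simpleGame_le_one (G := G) (H := H) T
  have h3 : (simpleGame G H).v S = 0 ∨ (simpleGame G H).v T = 0 := by
    by_contra! h
    exact simpleGame_not_disjoint hH (Nat.pos_of_ne_zero h.1) (Nat.pos_of_ne_zero h.2) hST
  have h4 : 0 < (simpleGame G H).v S → 0 < (simpleGame G H).v (S ∪ T) := fun h => by
    obtain ⟨-, B, hB, hBS⟩ := simpleGame_pos_iff.1 h
    exact simpleGame_pos_iff.2 ⟨hv, B, hB, hBS.trans Finset.subset_union_left⟩
  have h5 : 0 < (simpleGame G H).v T → 0 < (simpleGame G H).v (S ∪ T) := fun h => by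
    obtain ⟨-, B, hB, hBT⟩ := simpleGame_pos_iff.1 h
    exact simpleGame_pos_iff.2 ⟨hv, B, hB, hBT.trans Finset.subset_union_right⟩
  omega

theorem simpleGame_rho_le_one {H : Finset (Finset V)} (hH : IsThicket G H) :
    (simpleGame G H).rho ≤ 1 := by
  obtain ⟨⟨y, hy, hyr⟩, -⟩ := (simpleGame G H).isGreatest_rho
  rw [hyr]
  by_cases h : ∃ S, (simpleGame G H).v S * y S ≠ 0
  · obtain ⟨S, hS⟩ := h
    have hvS := Nat.pos_of_ne_zero (left_ne_zero_of_mul hS)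
    have hyS := Nat.pos_of_ne_zero (right_ne_zero_of_mul hS)
    have hle1 : ∀ i ∈ S, y S ≤ 1 := fun i hi =>
      (Finset.single_le_sum (f := y) (fun _ _ => Nat.zero_le _) (by simpa using hi)).trans (hy i)
    rw [Finset.sum_eq_single_of_mem S (Finset.mem_univ _)]
    · obtain ⟨i, hi⟩ := ((simpleGame G H).viable_of_pos hvS).nonempty
      exact Nat.mul_le_mul (simpleGame_le_one S) (hle1 i hi)
    · intro T _ hTS
      by_contra hT
      have hvT := Nat.pos_of_ne_zero (left_ne_zero_of_mul hT)
      have hyT := Nat.pos_of_ne_zero (right_ne_zero_of_mul hT)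
      obtain ⟨i, hiS, hiT⟩ := Finset.not_disjoint_iff.1 (simpleGame_not_disjoint hH hvS hvT)
      have h2 : ∑ U ∈ {S, T}, y U ≤ ∑ U : Finset V with i ∈ U, y U :=
        Finset.sum_le_sum_of_subset (by intro U; simp only [Finset.mem_insert,
          Finset.mem_singleton, Finset.mem_filter, Finset.mem_univ, true_and]
                                        rintro (rfl | rfl) <;> assumption)
      rw [Finset.sum_pair hTS.symm] at h2
      have := hy i
      omega
  · push Not at h
    simp [h]

theorem hittingSize_le_kappa {H : Finset (Finset V)} (hH : IsThicket G H) :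
    hittingSize H ≤ (simpleGame G H).kappa := by
  obtain ⟨⟨x, hx, hxk⟩, -⟩ := (simpleGame G H).isLeast_kappa
  rw [hxk]
  have hhit : IsHittingSet H {i | 0 < x i} := by
    intro S hS
    have h1 := (simpleGame_pos_iff.2 ⟨hH.1 S hS, S, hS, subset_rfl⟩).trans_le (hx S)
    obtain ⟨i, hi, h0⟩ := Finset.exists_ne_zero_of_sum_ne_zero h1.ne'
    exact ⟨i, hi, by simpa using Nat.pos_of_ne_zero h0⟩
  refine ((isLeast_hittingSize hH).2 ⟨_, hhit, rfl⟩).trans ?_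
  rw [Finset.card_filter]
  refine Finset.sum_le_sum fun i _ => ?_
  split_ifs <;> omega

theorem thicketNumber_pos [Nonempty V] (G : SimpleGraph V) : 0 < thicketNumber G := by
  obtain ⟨x⟩ := ‹Nonempty V›
  have hH : IsThicket G {{x}} := ⟨by simpa using viable_singleton x, by simp⟩
  refine lt_of_lt_of_le ?_ ((isGreatest_thicketNumber G).2 ⟨_, hH, rfl⟩)
  obtain ⟨⟨X, hX, hXc⟩, -⟩ := isLeast_hittingSize hH
  obtain ⟨i, -, hi⟩ := hX {x} (by simp)
  rw [hXc]
  exact Finset.card_pos.2 ⟨i, hi⟩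

end Games

end CoalitionGame

theorem theorem1 {V : Type*} [Fintype V] [DecidableEq V] [Nonempty V] (G : SimpleGraph V) :
    (∀ g : CoalitionGame.Game G,
      g.kappa ≤ CoalitionGame.thicketNumber G * g.rho ∧
      (0 < g.rho → (g.kappa : ℝ) / (g.rho : ℝ) ≤ (CoalitionGame.thicketNumber G : ℝ))) ∧
    (∃ g : CoalitionGame.Game G, g.Superadditive ∧ 0 < g.rho ∧
      (CoalitionGame.thicketNumber G : ℝ) ≤ (g.kappa : ℝ) / (g.rho : ℝ)) := by
  refine ⟨fun g => ⟨g.kappa_le, fun hpos => ?_⟩, ?_⟩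
  · rw [div_le_iff₀ (by exact_mod_cast hpos)]
    exact_mod_cast g.kappa_le
  · obtain ⟨⟨H, hH, hHt⟩, -⟩ := CoalitionGame.isGreatest_thicketNumber G
    have ht := CoalitionGame.thicketNumber_pos G
    obtain ⟨B, hB⟩ : H.Nonempty := by
      rw [Finset.nonempty_iff_ne_empty]
      rintro rfl
      have : CoalitionGame.hittingSize (∅ : Finset (Finset V)) ≤ 0 :=
        Nat.sInf_le ⟨∅, fun S hS => by simp at hS, rfl⟩
      omega
    have hB1 := (CoalitionGame.simpleGame_pos_iff.2 ⟨hH.1 B hB, B, hB, subset_rfl⟩).trans_le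
      ((CoalitionGame.simpleGame G H).le_rho B)
    have hrho : (CoalitionGame.simpleGame G H).rho = 1 :=
      le_antisymm (CoalitionGame.simpleGame_rho_le_one hH) hB1
    refine ⟨CoalitionGame.simpleGame G H, CoalitionGame.simpleGame_superadditive hH, hB1, ?_⟩
    rw [hrho, Nat.cast_one, div_one, hHt]
    exact_mod_cast CoalitionGame.hittingSize_le_kappa hH
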